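/- A combinatorial map $M=(C_M,v_M,f_M)$ is a connected finite cubic graph $C_M$ with two disjoint perfect matchings $v_M,f_M$ such that every component of $v_M\cup f_M$ is a polygon with $4$ edges (a square); let $a_M=E(C_M)\setminus(v_M\cup f_M)$ be the third perfect matching and $z_M$ the set of diagonals of the squares. A square together with its diagonals is a rectangle; $E$ is the set of rectangles. The $v$-, $f$- and $z$-gons of $M$ are the components of $a_M\cup v_M$, $a_M\cup f_M$ and $a_M\cup z_M$. Maps encode graphs cellularly embedded in closed surfaces, the $v$-gons, rectangles, $f$-gons and $z$-gons corresponding respectively to the vertices, edges, faces and zigzags. Let $D$ be the dual map of $M$ (in every rectangle $v_M$- and $f_M$-edges are interchanged), and let $P^\sim$ be the antimap of the phial map of $M$ (its $v$-, $f$- and $z$-edges are respectively the $z_M$-, $v_M$- and $f_M$-edges). All these maps have the same set $E$ of rectangles. Let $\mathcal E$ be the power set of $E$, regarded as a vector space over $GF(2)$ under symmetric difference. For a map $N$ with rectangle set $E$ and a single $v$-gon, going around this $v$-gon gives a cyclic sequence in which each element of $E$ occurs twice (once for each of its two $v_N$-edges). For $x\in E$ let $i_N(x)$ be the set of elements of $E$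 occurring exactly once between the two occurrences of $x$; let $\kappa_N(x)=\{x\}$ if the two $v_N$-edges of the rectangle $x$, oriented by going around the $v$-gon, point in opposite directions in the rectangle, and $\kappa_N(x)=\emptyset$ otherwise. Extend $i_N,\kappa_N$ linearly to $\mathcal E$ and put $c_N=\kappa_N+i_N$. Note that the $v$-gons of $D$ are the $f$-gons of $M$, and the $v$-gons of $P^\sim$ are the $z$-gons of $M$. **Theorem 4.** If $M$ has a single $f$-gon and a single $z$-gon (that is, the corresponding embedded graph has a single face and a single zigzag), then $c_{P^\sim}\circ c_D$ is the identity on $\mathcal E$. Hence $c_D$ is invertible and $c_D^{-1}=c_{P^\sim}$. -/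

import Mathlib

/-- The graph on `C` joining every `c` to `s c`, for the involutions `s` in a given list
of matchings (a matching is encoded by the involution exchanging the ends of its edges).
Only connectivity is read off this graph, so parallel edges may be merged. -/
def matchingGraph {C : Type*} (matchings : Set (C → C)) : SimpleGraph C :=
  SimpleGraph.fromRel fun c d => ∃ s ∈ matchings, d = s c

/-- A combinatorial map `(C_M, v_M, f_M)`. `C` is the vertex set of the connected cubic graph
`C_M`; the perfect matchings `v_M`, `f_M` and `a_M = E(C_M) - (v_M ∪ f_M)` are given by the
fixed-point-free involutions `v`, `f`, `a`. The components of `v_M ∪ f_M` are polygons with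
four edges, with vertices `c, v c, f (v c), f c` in this cyclic order.
`E` is the set of rectangles (equivalently of edges of the graph embedded in the surface), and
`edge c` is the rectangle containing the vertex `c`. -/
structure CombMap (C E : Type*) where
  /-- the matching `v_M` (short sides of the rectangles) -/
  v : C → C
  /-- the matching `f_M` (long sides of the rectangles) -/
  f : C → C
  /-- the matching `a_M` -/
  a : C → C
  v_invol : Function.Involutive v
  f_invol : Function.Involutive f
  a_invol : Function.Involutive a
  v_ne : ∀ c, v c ≠ c
  f_ne : ∀ c, f c ≠ c
  a_ne : ∀ c, a c ≠ c
  v_ne_f : ∀ c, v c ≠ f c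
  square : ∀ c, v (f c) = f (v c)
  connected : (matchingGraph {v, f, a}).Connected
  /-- the rectangle containing a vertex of `C_M` -/
  edge : C → E
  edge_surj : Function.Surjective edge
  edge_eq_iff : ∀ c d, edge c = edge d ↔ d = c ∨ d = v c ∨ d = f c ∨ d = f (v c)

namespace CombMap

variable {C E : Type*}

/-- The matching `z_M` formed by the diagonals of the squares. -/
def z (M : CombMap C E) (c : C) : C := M.f (M.v c)

theorem z_invol (M : CombMap C E) : Function.Involutive M.z := fun c => by
  simp only [z]
  rw [← M.square (M.f (M.v c)), M.f_invol, M.v_invol]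

theorem z_ne (M : CombMap C E) (c : C) : M.z c ≠ c := fun h =>
  M.v_ne_f c (by rw [← M.f_invol (M.v c)]; exact congrArg M.f h)

theorem f_z (M : CombMap C E) (c : C) : M.f (M.z c) = M.v c := M.f_invol _

theorem z_f (M : CombMap C E) (c : C) : M.z (M.f c) = M.v c := by
  rw [z, M.square, M.f_invol]

theorem z_v (M : CombMap C E) (c : C) : M.z (M.v c) = M.f c := by
  rw [z, M.v_invol]

theorem v_z (M : CombMap C E) (c : C) : M.v (M.z c) = M.f c := by
  rw [z, M.square, M.v_invol]

/-- If one set of matchings connects `C`, and every step of it can be made inside a second set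
of matchings, then the second set connects `C` as well. -/
theorem connected_of_steps {S T : Set (C → C)} (h : (matchingGraph S).Connected)
    (hST : ∀ s ∈ S, ∀ c, (matchingGraph T).Reachable c (s c)) : (matchingGraph T).Connected := by
  have : Nonempty C := h.nonempty
  refine ⟨fun c d => ?_⟩
  obtain ⟨w⟩ := h.preconnected c d
  induction w with
  | nil => exact SimpleGraph.Reachable.refl _
  | cons hadj _ ih =>
    refine SimpleGraph.Reachable.trans ?_ ih
    obtain ⟨_, ⟨s, hs, rfl⟩ | ⟨s, hs, rfl⟩⟩ := hadj
    · exact hST s hs _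
    · exact (hST s hs _).symm

theorem reachable_step {T : Set (C → C)} {s : C → C} (hs : s ∈ T) (c : C) :
    (matchingGraph T).Reachable c (s c) := by
  by_cases h : c = s c
  · rw [← h]
  · exact SimpleGraph.Adj.reachable ⟨h, Or.inl ⟨s, hs, rfl⟩⟩

/-- The dual map `D`: short and long sides of all rectangles are interchanged. -/
def dual (M : CombMap C E) : CombMap C E where
  v := M.f
  f := M.v
  a := M.a
  v_invol := M.f_invol
  f_invol := M.v_invol
  a_invol := M.a_invol
  v_ne := M.f_ne
  f_ne := M.v_ne
  a_ne := M.a_ne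
  v_ne_f c := (M.v_ne_f c).symm
  square c := (M.square c).symm
  connected := connected_of_steps M.connected (by
    rintro s (rfl | rfl | rfl) c <;> exact reachable_step (by simp) c)
  edge := M.edge
  edge_surj := M.edge_surj
  edge_eq_iff c d := by rw [M.edge_eq_iff, M.square]; tauto

/-- The phial map `P`: short sides and diagonals of all rectangles are interchanged. -/
def phial (M : CombMap C E) : CombMap C E where
  v := M.z
  f := M.f
  a := M.a
  v_invol := M.z_invol
  f_invol := M.f_invol
  a_invol := M.a_invol
  v_ne := M.z_ne
  f_ne := M.f_ne
  a_ne := M.a_ne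
  v_ne_f c h := M.v_ne c (M.f_invol.injective h)
  square c := by rw [M.z_f, M.f_z]
  connected := connected_of_steps M.connected (by
    rintro s (rfl | rfl | rfl) c
    · have h1 : (matchingGraph {M.z, M.f, M.a}).Reachable c (M.z c) :=
        reachable_step (by simp) c
      have h2 : (matchingGraph {M.z, M.f, M.a}).Reachable (M.z c) (M.f (M.z c)) :=
        reachable_step (by simp) _
      rw [M.f_z] at h2
      exact h1.trans h2
    · exact reachable_step (by simp) c
    · exact reachable_step (by simp) c)
  edge := M.edge
  edge_surj := M.edge_surj
  edge_eq_iff c d := by rw [M.edge_eq_iff, M.f_z, z]; tauto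

/-- The antimap `M~`: long sides and diagonals of all rectangles are interchanged. -/
def anti (M : CombMap C E) : CombMap C E where
  v := M.v
  f := M.z
  a := M.a
  v_invol := M.v_invol
  f_invol := M.z_invol
  a_invol := M.a_invol
  v_ne := M.v_ne
  f_ne := M.z_ne
  a_ne := M.a_ne
  v_ne_f c h := M.f_ne (M.v c) h.symm
  square c := by rw [M.v_z, M.z_v]
  connected := connected_of_steps M.connected (by
    rintro s (rfl | rfl | rfl) c
    · exact reachable_step (by simp) c
    · have h1 : (matchingGraph {M.v, M.z, M.a}).Reachable c (M.v c) :=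
        reachable_step (by simp) c
      have h2 : (matchingGraph {M.v, M.z, M.a}).Reachable (M.v c) (M.z (M.v c)) :=
        reachable_step (by simp) _
      rw [M.z_v] at h2
      exact h1.trans h2
    · exact reachable_step (by simp) c)
  edge := M.edge
  edge_surj := M.edge_surj
  edge_eq_iff c d := by rw [M.edge_eq_iff, M.z_v, z]; tauto

/-- The `f`-gons of `M`: components of `a_M ∪ f_M`; they are the faces of the embedded graph. -/
abbrev FGon (M : CombMap C E) : Type _ := (matchingGraph {M.a, M.f}).ConnectedComponent

/-- The `z`-gons of `M`: components of `a_M ∪ z_M`; they are the zigzags of the embedded graph. -/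
abbrev ZGon (M : CombMap C E) : Type _ := (matchingGraph {M.a, M.z}).ConnectedComponent

/-- Going around a `v`-gon. Starting at `c` along the short edge `c → v c`, and following the
`v`-gon of `c` in that direction, the `k`-th short edge met (counted from `0`) is
`walk c k → v (walk c k)`; consecutive short edges are linked by an `a_M`-edge. -/
def walk (M : CombMap C E) (c : C) (k : ℕ) : C := (fun d => M.a (M.v d))^[k] c

/-- The first positive time at which the walk around the `v`-gon from `c` meets
the rectangle of `c` again. -/
noncomputable def nextTime (M : CombMap C E) (c : C) : ℕ :=
  sInf {m | 0 < m ∧ M.edge (M.walk c m) = M.edge c}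

/-- For a map with a single `v`-gon: the set of the edges that occur exactly once, in the cyclic
sequence of edges read around the `v`-gon, between the two occurrences of `x`.
The vertex `c` of the rectangle `x` selects one of the two arcs and the direction in which it is
read; both arcs give the same set, as every edge occurs exactly twice in all. -/
def interlaced (M : CombMap C E) (x : E) : Set E :=
  {y | ∃ c, M.edge c = x ∧ ∃! k, 0 < k ∧ k < M.nextTime c ∧ M.edge (M.walk c k) = y}

/-- `x` is a balanced loop: both short edges of the rectangle `x` are on the same `v`-gon and,
when they are oriented by going around this `v`-gon, they point in opposite directions:
if one is `c → v c` then the other is `f (v c) → f c`, where `c, v c, f (v c), f c` is the cyclic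
order of the vertices of the rectangle. -/
def IsBalancedLoop (M : CombMap C E) (x : E) : Prop :=
  ∃ c, M.edge c = x ∧ ∃ k, M.walk c k = M.f (M.v c)

/-- A subset of `E` as a vector of the edge space `E → ZMod 2`, in which the
sum of subsets is their symmetric difference. -/
noncomputable def vec (X : Set E) : E → ZMod 2 := X.indicator 1

/-- The linear map `i_M` of the edge space, for a map with a single `v`-gon. -/
noncomputable def iMap [Finite E] (M : CombMap C E) : (E → ZMod 2) →ₗ[ZMod 2] (E → ZMod 2) :=
  (Pi.basisFun (ZMod 2) E).constr (ZMod 2) fun x => vec (M.interlaced x)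

/-- The linear map `κ_M` of the edge space: `κ_M(x) = x` if `x` is a balanced loop, and
`κ_M(x) = ∅` otherwise. -/
noncomputable def kappaMap [Finite E] (M : CombMap C E) :
    (E → ZMod 2) →ₗ[ZMod 2] (E → ZMod 2) :=
  (Pi.basisFun (ZMod 2) E).constr (ZMod 2) fun x => vec {y | y = x ∧ M.IsBalancedLoop x}

/-- The linear map `c_M = κ_M + i_M` of the edge space, for a map with a single `v`-gon. -/
noncomputable def cMap [Finite E] (M : CombMap C E) : (E → ZMod 2) →ₗ[ZMod 2] (E → ZMod 2) :=
  M.kappaMap + M.iMap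

end CombMap

/-!
For a map `N` with a single `v`-gon, `c_N X = Y` holds if and only if there is a *potential* for
`(X, Y)`: a function `g : C → ZMod 2` on the vertices which is constant along `a`-edges, changes
along the `v`-edges of a rectangle `y` by `X y`, and changes along its diagonals by `Y y`.

For `X = {x}` such a `g` is the indicator of an arc of the `v`-gon that joins the two occurrences
of `x` (`CombMap.arc`). It is constant along `a`-edges and along the `v`-edges of rectangles other
than `x`. If `y ≠ x`, then `g` changes along the diagonals of `y` exactly if one of the two
`v`-edges of `y` lies on the arc and the other does not, i.e. if `y` is interlaced with `x`. The arc
starts at the head of the first `v`-edge of `x` and stops at the tail of the second one, so `g`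
changes along the diagonals of `x` exactly if these two edges point in opposite directions.
Potentials add up, so every `X` has one (`CombMap.exists_isPotential`), and as the `v`-gon is
connected, `X` determines its potential up to a constant, hence determines `Y`.

Both for `D` and for `P^∼` the `a`-edges are those of `M`; the `v`-edges and diagonals are the
`f`- and `z`-edges of `M` for `D`, and the `z`- and `f`-edges of `M` for `P^∼`. So potentials of `D`
for `(X, Y)` are the same as potentials of `P^∼` for `(Y, X)`, which says that `c_D` and
`c_{P^∼}` are inverse to each other.
-/

namespace CombMap

variable {C E : Type*}

/-! ### The walk around a `v`-gon -/

theorem walk_zero (N : CombMap C E) (c : C) : N.walk c 0 = c := rfl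

theorem walk_succ (N : CombMap C E) (c : C) (k : ℕ) :
    N.walk c (k + 1) = N.a (N.v (N.walk c k)) :=
  Function.iterate_succ_apply' _ _ _

theorem walk_add (N : CombMap C E) (c : C) (j k : ℕ) :
    N.walk c (j + k) = N.walk (N.walk c k) j :=
  Function.iterate_add_apply _ _ _ _

theorem step_injective (N : CombMap C E) : Function.Injective fun d => N.a (N.v d) :=
  N.a_invol.injective.comp N.v_invol.injective

theorem walk_injective (N : CombMap C E) (k : ℕ) : Function.Injective fun c => N.walk c k :=
  N.step_injective.iterate k

theorem exists_walk_eq_self [Finite C] (N : CombMap C E) (c : C) :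
    ∃ m, 0 < m ∧ N.walk c m = c :=
  N.step_injective.mem_periodicPts c

theorem exists_walk_symm [Finite C] (N : CombMap C E) {c d : C} {k : ℕ} (h : N.walk c k = d) :
    ∃ j, N.walk d j = c := by
  obtain ⟨m, hm, hc⟩ := N.exists_walk_eq_self c
  have hper : Function.IsPeriodicPt (fun d => N.a (N.v d)) (m * (k + 1)) c :=
    Function.IsPeriodicPt.mul_const hc (k + 1)
  have hle : k ≤ m * (k + 1) := by nlinarith
  refine ⟨m * (k + 1) - k, ?_⟩
  rw [← h, ← walk_add, Nat.sub_add_cancel hle]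
  exact hper

/-- The walk traverses no `v`-edge in both directions: by reflection, this would produce a fixed
point of `a` or of `v` half-way between the two passages. -/
theorem walk_ne_v (N : CombMap C E) (k : ℕ) (c : C) : N.walk c k ≠ N.v c := by
  induction k using Nat.strong_induction_on generalizing c with
  | _ k ih =>
    intro h
    match k, ih, h with
    | 0, _, h => exact N.v_ne c h.symm
    | 1, _, h => exact N.a_ne _ h
    | k + 2, ih, h =>
      refine ih k (by omega) (N.walk c 1) ?_
      rw [← walk_add]
      rw [walk_succ] at h
      rw [← N.v_invol (N.walk c (k + 1)), ← N.a_invol (N.v (N.walk c (k + 1))), h]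
      rfl

theorem not_walk_of_walk_v [Finite C] (N : CombMap C E) {c d : C} {j k : ℕ}
    (hj : N.walk c j = d) : N.walk c k ≠ N.v d := by
  obtain ⟨m, hm⟩ := N.exists_walk_symm hj
  intro hk
  apply N.walk_ne_v (k + m) d
  rw [walk_add, hm, hk]

/-! ### The first return to a rectangle -/

theorem edge_v (N : CombMap C E) (c : C) : N.edge (N.v c) = N.edge c :=
  ((N.edge_eq_iff _ _).2 (by simp)).symm

theorem edge_f (N : CombMap C E) (c : C) : N.edge (N.f c) = N.edge c :=
  ((N.edge_eq_iff _ _).2 (by simp)).symm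

theorem edge_z (N : CombMap C E) (c : C) : N.edge (N.z c) = N.edge c :=
  (N.edge_f _).trans (N.edge_v c)

theorem nextTime_spec [Finite C] (N : CombMap C E) (c : C) :
    0 < N.nextTime c ∧ N.edge (N.walk c (N.nextTime c)) = N.edge c := by
  obtain ⟨m, hm, h⟩ := N.exists_walk_eq_self c
  exact Nat.sInf_mem (s := {m | 0 < m ∧ N.edge (N.walk c m) = N.edge c}) ⟨m, hm, by rw [h]⟩

theorem edge_walk_ne (N : CombMap C E) {c : C} {k : ℕ} (hk : 0 < k) (hk' : k < N.nextTime c) :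
    N.edge (N.walk c k) ≠ N.edge c :=
  fun h => Nat.notMem_of_lt_sInf hk' ⟨hk, h⟩

/-- Before the first return to the initial rectangle, the walk meets no vertex twice. -/
theorem walk_inj_of_lt_nextTime (N : CombMap C E) {c : C} {j k : ℕ} (hj : j < N.nextTime c)
    (hk : k < N.nextTime c) (h : N.walk c j = N.walk c k) : j = k := by
  wlog hjk : j < k generalizing j k
  · rcases Nat.lt_or_ge k j with h' | h'
    · exact (this hk hj h.symm h').symm
    · omega
  exfalso
  refine N.edge_walk_ne (c := c) (k := k - j) (by omega) (by omega) (congrArg N.edge ?_)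
  apply N.walk_injective j
  change N.walk (N.walk c (k - j)) j = N.walk c j
  rw [← walk_add, h]
  congr 1
  omega

/-- `N` has a single `v`-gon. -/
def HasSingleVGon (N : CombMap C E) : Prop := (matchingGraph {N.a, N.v}).Preconnected

theorem HasSingleVGon.eq_of_invariant {N : CombMap C E} (hN : N.HasSingleVGon) {α : Type*}
    {h : C → α} (ha : ∀ d, h (N.a d) = h d) (hv : ∀ d, h (N.v d) = h d) (c d : C) :
    h c = h d := by
  obtain ⟨w⟩ := hN c d
  induction w with
  | nil => rfl
  | cons hadj _ ih =>
    rw [← ih]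
    obtain ⟨_, ⟨s, rfl | rfl, rfl⟩ | ⟨s, rfl | rfl, rfl⟩⟩ := hadj <;> simp [ha, hv]

/-- The first return is not to the initial vertex: otherwise the `v`-gon would close up without
passing the other `v`-edge of the rectangle. -/
theorem walk_nextTime_ne_self [Finite C] {N : CombMap C E} (hN : N.HasSingleVGon) (c : C) :
    N.walk c (N.nextTime c) ≠ c := by
  intro h
  obtain ⟨hpos, -⟩ := N.nextTime_spec c
  let S : Set C := {d | ∃ k < N.nextTime c, d = N.walk c k ∨ d = N.v (N.walk c k)}
  have hv : ∀ d ∈ S, N.v d ∈ S := by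
    rintro d ⟨k, hk, rfl | rfl⟩
    · exact ⟨k, hk, Or.inr rfl⟩
    · exact ⟨k, hk, Or.inl (N.v_invol _)⟩
  have ha : ∀ d ∈ S, N.a d ∈ S := by
    rintro d ⟨k, hk, rfl | rfl⟩
    · rcases k with _ | k
      · refine ⟨N.nextTime c - 1, by omega, Or.inr ?_⟩
        have : N.walk c (N.nextTime c - 1 + 1) = c := by rw [Nat.sub_add_cancel hpos, h]
        rw [walk_succ] at this
        rw [walk_zero, ← N.a_invol (N.v _), this]
      · refine ⟨k, by omega, Or.inr ?_⟩
        rw [walk_succ, N.a_invol]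
    · rcases Nat.lt_or_ge (k + 1) (N.nextTime c) with hk' | hk'
      · exact ⟨k + 1, hk', Or.inl (N.walk_succ c k).symm⟩
      · refine ⟨0, hpos, Or.inl ?_⟩
        rw [← walk_succ, show k + 1 = N.nextTime c by omega, h, walk_zero]
  have hf : N.f c ∈ S := by
    have := hN.eq_of_invariant (h := fun d => d ∈ S)
      (fun d => propext ⟨fun hd => N.a_invol d ▸ ha _ hd, ha d⟩)
      (fun d => propext ⟨fun hd => N.v_invol d ▸ hv _ hd, hv d⟩) c (N.f c)
    exact this.mp ⟨0, hpos, Or.inl rfl⟩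
  obtain ⟨k, hk, hfk⟩ := hf
  have hk0 : k = 0 := by
    by_contra hk0
    apply N.edge_walk_ne (Nat.pos_of_ne_zero hk0) hk
    rcases hfk with hfk | hfk
    · rw [← hfk, N.edge_f]
    · rw [← N.edge_v, ← hfk, N.edge_f]
  subst hk0
  rcases hfk with hfk | hfk
  · exact N.f_ne c hfk
  · exact N.v_ne_f c hfk.symm

theorem walk_nextTime [Finite C] {N : CombMap C E} (hN : N.HasSingleVGon) (c : C) :
    N.walk c (N.nextTime c) = N.f c ∨ N.walk c (N.nextTime c) = N.z c := by
  rcases (N.edge_eq_iff _ _).1 (N.nextTime_spec c).2.symm with h | h | h | h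
  · exact absurd h (walk_nextTime_ne_self hN c)
  · exact absurd h (N.walk_ne_v _ c)
  · exact Or.inl h
  · exact Or.inr h

/-- The first return ends at the diagonally opposite vertex exactly if the two short edges of the
rectangle point in opposite directions. -/
theorem isBalancedLoop_iff [Finite C] {N : CombMap C E} (hN : N.HasSingleVGon) (c : C) :
    N.IsBalancedLoop (N.edge c) ↔ N.walk c (N.nextTime c) = N.z c := by
  refine ⟨fun ⟨d, hd, k, hk⟩ => ?_, fun h => ⟨c, rfl, _, h⟩⟩
  refine (walk_nextTime hN c).resolve_left fun h => ?_
  change N.walk d k = N.z d at hk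
  rcases (N.edge_eq_iff _ _).1 hd.symm with rfl | rfl | rfl | rfl
  · refine N.not_walk_of_walk_v hk (k := N.nextTime d) ?_
    rw [h, N.v_z]
  · rw [N.z_v] at hk
    obtain ⟨m, hm⟩ := N.exists_walk_symm hk
    exact N.walk_ne_v (m + N.nextTime c) c (by rw [walk_add, h, hm])
  · rw [N.z_f] at hk
    exact N.walk_ne_v (k + N.nextTime c) c (by rw [walk_add, h, hk])
  · change N.walk (N.z c) k = N.z (N.z c) at hk
    rw [N.z_invol] at hk
    refine N.walk_ne_v (N.nextTime c + k) (N.z c) ?_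
    rw [walk_add, hk, h, N.v_z]

/-! ### The arc between the two occurrences of a rectangle -/

/-- The vertices of the `v`-gon met by the walk from `c`, from the end `v c` of the first short
edge up to the first vertex in the rectangle of `c` met afterwards. -/
def arc (N : CombMap C E) (c : C) : Set C :=
  {d | ∃ k < N.nextTime c, d = N.v (N.walk c k) ∨ d = N.walk c (k + 1)}

theorem a_mem_arc {N : CombMap C E} {c d : C} : N.a d ∈ N.arc c ↔ d ∈ N.arc c := by
  have key : ∀ d ∈ N.arc c, N.a d ∈ N.arc c := by
    rintro d ⟨k, hk, rfl | rfl⟩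
    · exact ⟨k, hk, Or.inr (N.walk_succ c k).symm⟩
    · exact ⟨k, hk, Or.inl (by rw [walk_succ, N.a_invol])⟩
  exact ⟨fun h => N.a_invol d ▸ key _ h, key d⟩

theorem mem_arc_of_edge_ne [Finite C] {N : CombMap C E} {c d : C} (hd : N.edge d ≠ N.edge c) :
    d ∈ N.arc c ↔
      ∃ k, 0 < k ∧ k < N.nextTime c ∧ (N.walk c k = d ∨ N.walk c k = N.v d) := by
  constructor
  · rintro ⟨k, hk, rfl | rfl⟩
    · have : k ≠ 0 := by
        rintro rfl
        exact hd (N.edge_v c)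
      exact ⟨k, by omega, hk, Or.inr (N.v_invol _).symm⟩
    · have : k + 1 ≠ N.nextTime c := fun h => hd (h ▸ (N.nextTime_spec c).2)
      exact ⟨k + 1, by omega, by omega, Or.inl rfl⟩
  · rintro ⟨k, hk0, hk, h | h⟩
    · exact ⟨k - 1, by omega, Or.inr (by rw [Nat.sub_add_cancel hk0, h])⟩
    · exact ⟨k, hk, Or.inl (by rw [h, N.v_invol])⟩

theorem mem_arc_of_edge_eq [Finite C] {N : CombMap C E} {c d : C} (hd : N.edge d = N.edge c) :
    d ∈ N.arc c ↔ d = N.v c ∨ d = N.walk c (N.nextTime c) := by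
  constructor
  · rintro ⟨k, hk, rfl | rfl⟩
    · rcases Nat.eq_zero_or_pos k with rfl | hk0
      · exact Or.inl rfl
      · rw [N.edge_v] at hd
        exact absurd hd (N.edge_walk_ne hk0 hk)
    · refine Or.inr ?_
      rcases Nat.lt_or_ge (k + 1) (N.nextTime c) with hk' | hk'
      · exact absurd hd (N.edge_walk_ne (by omega) hk')
      · rw [show k + 1 = N.nextTime c by omega]
  · have hpos := (N.nextTime_spec c).1
    rintro (rfl | rfl)
    · exact ⟨0, hpos, Or.inl rfl⟩
    · exact ⟨N.nextTime c - 1, by omega, Or.inr (by rw [Nat.sub_add_cancel hpos])⟩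

theorem v_mem_arc_of_edge_ne [Finite C] {N : CombMap C E} {c d : C}
    (hd : N.edge d ≠ N.edge c) : N.v d ∈ N.arc c ↔ d ∈ N.arc c := by
  rw [mem_arc_of_edge_ne hd, mem_arc_of_edge_ne (by rwa [N.edge_v]), N.v_invol]
  simp only [or_comm]

/-- The arc contains exactly one end of each of the two short edges of its rectangle. -/
theorem v_mem_arc_of_edge_eq [Finite C] {N : CombMap C E} (hN : N.HasSingleVGon) {c d : C}
    (hd : N.edge d = N.edge c) : N.v d ∈ N.arc c ↔ d ∉ N.arc c := by
  rw [mem_arc_of_edge_eq hd, mem_arc_of_edge_eq (by rwa [N.edge_v])]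
  have h1 := N.v_ne c
  have h2 := N.v_ne_f c
  have h3 := N.z_ne c
  have h4 := N.f_ne c
  have h5 : N.z c ≠ N.v c := N.f_ne _
  have h6 : N.z c ≠ N.f c := fun h => N.v_ne c (N.f_invol.injective h)
  have h7 : N.v (N.f c) = N.z c := N.square c
  have h8 := N.v_invol c
  have h9 := N.v_z c
  rcases walk_nextTime hN c with h | h <;> rw [h] <;>
  rcases (N.edge_eq_iff _ _).1 hd.symm with rfl | rfl | rfl | (rfl : d = N.z c) <;> grind

theorem z_mem_arc_of_edge_eq [Finite C] {N : CombMap C E} (hN : N.HasSingleVGon) {c d : C}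
    (hd : N.edge d = N.edge c) :
    (N.z d ∈ N.arc c ↔ d ∉ N.arc c) ↔ N.IsBalancedLoop (N.edge c) := by
  rw [isBalancedLoop_iff hN, mem_arc_of_edge_eq hd, mem_arc_of_edge_eq (by rwa [N.edge_z])]
  have h1 := N.v_ne c
  have h2 := N.v_ne_f c
  have h3 := N.z_ne c
  have h4 := N.f_ne c
  have h5 : N.z c ≠ N.v c := N.f_ne _
  have h6 : N.z c ≠ N.f c := fun h => N.v_ne c (N.f_invol.injective h)
  have h7 := N.z_v c
  have h8 := N.z_f c
  have h9 := N.z_invol c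
  rcases walk_nextTime hN c with h | h <;> rw [h] <;>
  rcases (N.edge_eq_iff _ _).1 hd.symm with rfl | rfl | rfl | (rfl : d = N.z c) <;> grind

/-- A rectangle occurs exactly once inside the arc if and only if the arc contains exactly one of
its two short edges. -/
theorem z_mem_arc_of_edge_ne [Finite C] {N : CombMap C E} {c d : C}
    (hd : N.edge d ≠ N.edge c) :
    (N.z d ∈ N.arc c ↔ d ∉ N.arc c) ↔
      ∃! k, 0 < k ∧ k < N.nextTime c ∧ N.edge (N.walk c k) = N.edge d := by
  -- a short edge is passed at most once before the first return
  have huniq : ∀ d j k, j < N.nextTime c → k < N.nextTime c →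
      (N.walk c j = d ∨ N.walk c j = N.v d) → (N.walk c k = d ∨ N.walk c k = N.v d) → j = k := by
    rintro d j k hj hk (h | h) (h' | h')
    · exact N.walk_inj_of_lt_nextTime hj hk (h.trans h'.symm)
    · exact absurd h' (N.not_walk_of_walk_v h)
    · exact absurd h (N.not_walk_of_walk_v h')
    · exact N.walk_inj_of_lt_nextTime hj hk (h.trans h'.symm)
  have hedge : ∀ k, N.edge (N.walk c k) = N.edge d ↔
      (N.walk c k = d ∨ N.walk c k = N.v d) ∨
        (N.walk c k = N.z d ∨ N.walk c k = N.v (N.z d)) := by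
    intro k
    rw [eq_comm, N.edge_eq_iff, N.v_z, z]
    tauto
  have hdisj : ∀ k, (N.walk c k = d ∨ N.walk c k = N.v d) →
      ¬ (N.walk c k = N.z d ∨ N.walk c k = N.v (N.z d)) := by
    have h1 := N.z_ne d
    have h2 := N.f_ne d
    have h3 := N.v_ne_f d
    have h5 : N.z d ≠ N.v d := N.f_ne _
    rw [N.v_z]
    rintro k (h | h) (h' | h') <;> rw [h] at h'
    · exact h1 h'.symm
    · exact h2 h'.symm
    · exact h5 h'.symm
    · exact h3 h'
  rw [mem_arc_of_edge_ne hd, mem_arc_of_edge_ne (d := N.z d) (by rwa [N.edge_z])]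
  simp only [hedge]
  constructor
  · intro h
    by_cases hm : ∃ k, 0 < k ∧ k < N.nextTime c ∧ (N.walk c k = d ∨ N.walk c k = N.v d)
    · have hn := fun hz => (h.1 hz) hm
      obtain ⟨k, hk0, hk, hkd⟩ := hm
      refine ⟨k, ⟨hk0, hk, Or.inl hkd⟩, ?_⟩
      rintro j ⟨hj0, hj, hjd | hjd⟩
      · exact huniq d j k hj hk hjd hkd
      · exact absurd ⟨j, hj0, hj, hjd⟩ hn
    · obtain ⟨k, hk0, hk, hkd⟩ := h.2 hm
      refine ⟨k, ⟨hk0, hk, Or.inr hkd⟩, ?_⟩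
      rintro j ⟨hj0, hj, hjd | hjd⟩
      · exact absurd ⟨j, hj0, hj, hjd⟩ hm
      · exact huniq _ j k hj hk hjd hkd
  · rintro ⟨k, ⟨hk0, hk, hkd⟩, hu⟩
    constructor
    · rintro ⟨i, hi0, hi, hid⟩ ⟨j, hj0, hj, hjd⟩
      have hik := hu i ⟨hi0, hi, Or.inr hid⟩
      have hjk := hu j ⟨hj0, hj, Or.inl hjd⟩
      subst hik hjk
      exact hdisj _ hjd hid
    · intro hn
      rcases hkd with hkd | hkd
      · exact absurd ⟨k, hk0, hk, hkd⟩ hn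
      · exact ⟨k, hk0, hk, hkd⟩

/-! ### Potentials -/

/-- A function on the vertices with values in `GF(2)` that is constant along `a`-edges, changes
along the `v`-edges of each rectangle by the value of `X`, and along its diagonals by that of `Y`. -/
structure IsPotential (N : CombMap C E) (X Y : E → ZMod 2) (g : C → ZMod 2) : Prop where
  map_a : ∀ d, g (N.a d) = g d
  map_v : ∀ d, g (N.v d) = g d + X (N.edge d)
  map_z : ∀ d, g (N.z d) = g d + Y (N.edge d)

/-- With a single `v`-gon, potentials of `X` differ by constants, so `X` determines `Y`. -/
theorem IsPotential.unique {N : CombMap C E} (hN : N.HasSingleVGon) {X Y Y' : E → ZMod 2}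
    {g g' : C → ZMod 2} (h : N.IsPotential X Y g) (h' : N.IsPotential X Y' g') : Y = Y' := by
  funext y
  obtain ⟨d, rfl⟩ := N.edge_surj y
  have := hN.eq_of_invariant (h := fun d => g d - g' d) (fun d => by rw [h.map_a, h'.map_a])
    (fun d => by rw [h.map_v, h'.map_v]; ring) (N.z d) d
  simp only [h.map_z, h'.map_z] at this
  linear_combination this

theorem indicator_eq_add_iff {α : Type*} {S : Set α} {p q : α} {P : Prop} [Decidable P]
    (h : (p ∈ S ↔ q ∉ S) ↔ P) :
    (S.indicator 1 p : ZMod 2) = S.indicator 1 q + if P then 1 else 0 := by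
  have h2 : (1 : ZMod 2) + 1 = 0 := rfl
  by_cases hp : p ∈ S <;> by_cases hq : q ∈ S <;> by_cases hP : P <;> simp_all

open Classical in
/-- The indicator of an arc between the two occurrences of a rectangle is a potential. -/
theorem isPotential_arc [Finite C] {N : CombMap C E} (hN : N.HasSingleVGon) (c : C) :
    N.IsPotential (Pi.single (N.edge c) 1)
      (fun y => if (y = N.edge c ∧ N.IsBalancedLoop (N.edge c)) ∨ (y ≠ N.edge c ∧
        ∃! k, 0 < k ∧ k < N.nextTime c ∧ N.edge (N.walk c k) = y) then 1 else 0)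
      ((N.arc c).indicator 1) where
  map_a d := by simp only [Set.indicator, a_mem_arc, Pi.one_apply]
  map_v d := by
    rw [Pi.single_apply]
    refine indicator_eq_add_iff ?_
    by_cases hd : N.edge d = N.edge c
    · simp [v_mem_arc_of_edge_eq hN hd, hd]
    · simp [v_mem_arc_of_edge_ne hd, hd]
  map_z d := by
    refine indicator_eq_add_iff ?_
    by_cases hd : N.edge d = N.edge c
    · rw [z_mem_arc_of_edge_eq hN hd]
      simp [hd]
    · rw [z_mem_arc_of_edge_ne hd]
      simp [hd]

/-- Any vertex of the rectangle `x` may be used to decide which rectangles are interlaced with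
`x`. -/
theorem mem_interlaced_iff [Finite C] {N : CombMap C E} (hN : N.HasSingleVGon) (c : C) (y : E) :
    y ∈ N.interlaced (N.edge c) ↔ y ≠ N.edge c ∧
      ∃! k, 0 < k ∧ k < N.nextTime c ∧ N.edge (N.walk c k) = y := by
  constructor
  · rintro ⟨d, hd, h⟩
    have hy : y ≠ N.edge d := by
      rintro rfl
      obtain ⟨k, ⟨hk0, hk, hkd⟩, -⟩ := h
      exact N.edge_walk_ne hk0 hk hkd
    have hc := isPotential_arc hN c
    have hd' := isPotential_arc hN d
    rw [hd] at hd'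
    have := congrFun (hc.unique hN hd') y
    rw [hd] at hy
    simpa [hy, h] using this
  · rintro ⟨-, h⟩
    exact ⟨c, rfl, h⟩

open Classical in
theorem cMap_single [Finite C] [Finite E] {N : CombMap C E}
    (hN : N.HasSingleVGon) (c : C) : ∃ g,
    N.IsPotential (Pi.single (N.edge c) 1) (N.cMap (Pi.single (N.edge c) 1)) g := by
  refine ⟨(N.arc c).indicator 1, ?_⟩
  convert isPotential_arc hN c using 1
  have hk : N.kappaMap (Pi.single (N.edge c) 1) =
      vec {y | y = N.edge c ∧ N.IsBalancedLoop (N.edge c)} := by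
    rw [kappaMap, ← Pi.basisFun_apply, Module.Basis.constr_basis]
  have hi : N.iMap (Pi.single (N.edge c) 1) = vec (N.interlaced (N.edge c)) := by
    rw [iMap, ← Pi.basisFun_apply, Module.Basis.constr_basis]
  funext y
  rw [cMap, LinearMap.add_apply, hk, hi, Pi.add_apply]
  simp only [vec, Set.indicator, Set.mem_ofPred_eq, mem_interlaced_iff hN]
  by_cases hy : y = N.edge c <;> simp [hy]

theorem exists_isPotential [Finite C] [Finite E] {N : CombMap C E} (hN : N.HasSingleVGon)
    (X : E → ZMod 2) : ∃ g, N.IsPotential X (N.cMap X) g := by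
  classical
  have : Fintype E := Fintype.ofFinite E
  choose e he using N.edge_surj
  have hg : ∀ x, ∃ g, N.IsPotential (Pi.single x 1) (N.cMap (Pi.single x 1)) g := fun x => by
    obtain ⟨c, rfl⟩ := N.edge_surj x
    exact cMap_single hN c
  choose g hg using hg
  have hX : X = ∑ x, X x • Pi.single x (1 : ZMod 2) := pi_eq_sum_univ' X
  have hcX : N.cMap X = ∑ x, X x • N.cMap (Pi.single x 1) := by
    conv_lhs => rw [hX]
    simp only [map_sum, map_smul]
  refine ⟨fun d => ∑ x, X x * g x d, fun d => ?_, fun d => ?_, fun d => ?_⟩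
  · simp only [(hg _).map_a]
  · simp only [(hg _).map_v, mul_add, Finset.sum_add_distrib]
    congr 1
    conv_rhs => rw [hX]
    simp
  · simp only [(hg _).map_z, mul_add, Finset.sum_add_distrib]
    rw [hcX]
    simp

/-- If the `v`-edges of each of two maps are the diagonals of the other one, then their
potentials are the same with `X` and `Y` exchanged. -/
theorem cMap_comp_cMap [Finite C] [Finite E] {N N' : CombMap C E} (hN : N.HasSingleVGon)
    (hN' : N'.HasSingleVGon) (ha : N'.a = N.a) (hv : ∀ c, N'.v c = N.z c)
    (hz : ∀ c, N'.z c = N.v c) (he : N'.edge = N.edge) :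
    N'.cMap ∘ₗ N.cMap = LinearMap.id := by
  refine LinearMap.ext fun X => ?_
  obtain ⟨g, hg⟩ := exists_isPotential hN X
  obtain ⟨g', hg'⟩ := exists_isPotential hN' (N.cMap X)
  have hg'' : N'.IsPotential (N.cMap X) X g :=
    ⟨fun d => by rw [ha, hg.map_a], fun d => by rw [hv, he, hg.map_z],
      fun d => by rw [hz, he, hg.map_v]⟩
  exact hg'.unique hN' hg''

theorem preconnected_of_card_connectedComponent {V : Type*} {G : SimpleGraph V}
    (h : Nat.card G.ConnectedComponent = 1) : G.Preconnected := fun c d => by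
  have := (Nat.card_eq_one_iff_unique.1 h).1
  exact SimpleGraph.ConnectedComponent.exact (Subsingleton.elim _ _)

end CombMap

theorem theorem4 {C E : Type*} [Finite C] [Finite E] (M : CombMap C E)
    (hface : Nat.card M.FGon = 1) (hzigzag : Nat.card M.ZGon = 1) :
    M.phial.anti.cMap ∘ₗ M.dual.cMap = LinearMap.id ∧
      M.dual.cMap ∘ₗ M.phial.anti.cMap = LinearMap.id := by
  have hD : M.dual.HasSingleVGon := CombMap.preconnected_of_card_connectedComponent hface
  have hP : M.phial.anti.HasSingleVGon := CombMap.preconnected_of_card_connectedComponent hzigzag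
  have hz : ∀ c, M.dual.z c = M.z c := M.square
  have hz' : ∀ c, M.phial.anti.z c = M.f c := fun c => by
    change M.f (M.z (M.z c)) = M.f c
    rw [M.z_invol]
  exact ⟨CombMap.cMap_comp_cMap hD hP rfl (fun c => (hz c).symm) hz' rfl,
    CombMap.cMap_comp_cMap hP hD rfl (fun c => (hz' c).symm) hz rfl⟩
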